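/- Let $d\in\mathbb{N}$, let $A$ be a $d\times d$ Hermitian matrix, let $\rho$ be a $d\times d$ density matrix ($\rho\ge 0$, $\operatorname{Tr}\rho=1$), and let $T_1,T_2>0$. For $T>0$ put $$M_T(A):=\left(e^{A/T}+I\right)^{-1},\qquad \ell_T(p):=\frac{e^{p/T}}{T\,(e^{p/T}+1)^2}\quad(p\in\mathbb{R}).$$ Consider a control qumode with Hilbert space $L^2(\mathbb{R})$, position operator $\hat x$ (multiplication by $x$ on position wave functions) and momentum basis $\{|p\rangle\}_{p\in\mathbb{R}}$ normalized so that $\langle p|x\rangle=(2\pi)^{-1/2}e^{ipx}$, that is, the momentum wave function of $f$ is $\langle p|f\rangle=(2\pi)^{-1/2}\int_{\mathbb{R}} e^{ipx}f(x)\,dx$ (extended unitarily to $L^2(\mathbb{R})$). Let $|\psi_T\rangle:=\int_{\mathbb{R}}\sqrt{\ell_T(p)}\,|p\rangle\,dp$. Consider the following algorithm. 1. Prepare the control qumode in the state $|\psi_{T_1}\rangle\langle\psi_{T_1}|$ and a $d$-dimensional data register in the state $\rho$. 2. Apply the Hamiltonian evolution $e^{-i\hat x\otimes A/T_2}$ to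 the control and data registers. 3. Measure the control register in the momentum basis $\{|p\rangle\}_{p\in\mathbb{R}}$, obtaining an outcome $p\in\mathbb{R}$. 4. Output $0$ if $p\ge 0$ and $1$ if $p<0$. Then the algorithm outputs $0$ with probability $\operatorname{Tr}\!\left[(I-M_{T_1T_2}(A))\rho\right]$ and outputs $1$ with probability $\operatorname{Tr}\!\left[M_{T_1T_2}(A)\rho\right]$; that is, it realizes the Fermi–Dirac thermal measurement of $A$ at temperature $T_1T_2$ on $\rho$. -/

import Mathlib

open MeasureTheory Filter Topology
open scoped ENNReal InnerProductSpace ComplexOrder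

noncomputable section

namespace FermiDirac

/-! ### Hilbert spaces -/

/-- The qumode Hilbert space `L²(ℝ; ℂ)`. A vector may be written in the position or in the
momentum representation; unless stated otherwise it is a position wave function. -/
abbrev Qumode : Type := Lp ℂ 2 (volume : Measure ℝ)

/-- The Hilbert space `ℂ^d` of the data register. -/
abbrev Data (d : ℕ) : Type := EuclideanSpace ℂ (Fin d)

/-- The Hilbert space `L²(ℝ; ℂ) ⊗ ℂ^d = L²(ℝ; ℂ^d)` of control qumode and data register,
in the position representation of the qumode. -/
abbrev Joint (d : ℕ) : Type := Lp (Data d) 2 (volume : Measure ℝ)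

/-! ### Multiplication operators -/

section Multiplication

variable {E : Type*} [NormedAddCommGroup E] [NormedSpace ℂ E]

theorem memLp_mul (m : ℝ → E →L[ℂ] E) (hm : StronglyMeasurable m) (hb : ∀ x, ‖m x‖ ≤ 1)
    (f : Lp E 2 (volume : Measure ℝ)) : MemLp (fun x => m x (f x)) 2 (volume : Measure ℝ) := by
  refine (Lp.memLp f).mono ?_ (Eventually.of_forall fun x => ?_)
  · exact (ContinuousLinearMap.id ℂ (E →L[ℂ] E)).aestronglyMeasurable_comp₂
      hm.aestronglyMeasurable (Lp.aestronglyMeasurable f)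
  · simpa using (m x).le_of_opNorm_le (hb x) (f x)

/-- The bounded operator on `L²(ℝ; E)` given by `(mulOp m f)(x) = m(x) f(x)`, for a measurable
family `m` of operators on `E` of norm at most one. -/
def mulOp (m : ℝ → E →L[ℂ] E) (hm : StronglyMeasurable m) (hb : ∀ x, ‖m x‖ ≤ 1) :
    Lp E 2 (volume : Measure ℝ) →L[ℂ] Lp E 2 (volume : Measure ℝ) :=
  LinearMap.mkContinuous
    { toFun := fun f => (memLp_mul m hm hb f).toLp _
      map_add' := fun f g => by
        rw [← MemLp.toLp_add]
        refine MemLp.toLp_congr _ _ ?_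
        filter_upwards [Lp.coeFn_add f g] with x hx
        rw [hx]
        simp
      map_smul' := fun c f => by
        rw [RingHom.id_apply, ← MemLp.toLp_const_smul]
        refine MemLp.toLp_congr _ _ ?_
        filter_upwards [Lp.coeFn_smul c f] with x hx
        rw [hx]
        simp }
    1
    (fun f => by
      refine Lp.norm_le_mul_norm_of_ae_le_mul ?_
      filter_upwards [(memLp_mul m hm hb f).coeFn_toLp] with x hx
      simp only [LinearMap.coe_mk, AddHom.coe_mk, hx]
      exact (m x).le_of_opNorm_le (hb x) (f x))

theorem coeFn_mulOp (m : ℝ → E →L[ℂ] E) (hm : StronglyMeasurable m) (hb : ∀ x, ‖m x‖ ≤ 1)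
    (f : Lp E 2 (volume : Measure ℝ)) : mulOp m hm hb f =ᵐ[volume] fun x => m x (f x) :=
  (memLp_mul m hm hb f).coeFn_toLp

end Multiplication

/-! ### The momentum basis -/

theorem memLp_dilation {c : ℝ} (hc : 0 < c) (f : Qumode) :
    MemLp (fun x => ((Real.sqrt c : ℝ) : ℂ) * f (c * x)) 2 (volume : Measure ℝ) := by
  have hmap := Real.map_volume_mul_left hc.ne'
  have h1 : MemLp (f : ℝ → ℂ) 2 (Measure.map (c * ·) (volume : Measure ℝ)) := by
    rw [hmap]
    exact (Lp.memLp f).smul_measure ENNReal.ofReal_ne_top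
  exact (h1.comp_of_map (by fun_prop)).const_mul _

theorem eLpNorm_dilation {c : ℝ} (hc : 0 < c) (f : Qumode) :
    eLpNorm (fun x => ((Real.sqrt c : ℝ) : ℂ) * f (c * x)) 2 (volume : Measure ℝ)
      = eLpNorm f 2 (volume : Measure ℝ) := by
  have hsm := Real.smul_map_volume_mul_left hc.ne'
  have h1 : AEStronglyMeasurable (f : ℝ → ℂ) (Measure.map (c * ·) (volume : Measure ℝ)) := by
    rw [Real.map_volume_mul_left hc.ne']
    exact (Lp.aestronglyMeasurable f).smul_measure _
  have h2 := eLpNorm_map_measure (p := 2) h1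
    (by fun_prop : AEMeasurable (c * ·) (volume : Measure ℝ))
  have h3 : eLpNorm (fun x => ((Real.sqrt c : ℝ) : ℂ) * f (c * x)) 2 (volume : Measure ℝ)
      = ENNReal.ofReal (Real.sqrt c) * eLpNorm f 2 (Measure.map (c * ·) (volume : Measure ℝ)) := by
    rw [h2]
    have := eLpNorm_const_smul ((Real.sqrt c : ℝ) : ℂ) ((f : ℝ → ℂ) ∘ (c * ·)) 2
      (volume : Measure ℝ)
    have he : ‖((Real.sqrt c : ℝ) : ℂ)‖ₑ = ENNReal.ofReal (Real.sqrt c) := by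
      rw [← ofReal_norm, Complex.norm_real, Real.norm_of_nonneg (Real.sqrt_nonneg c)]
    rw [he] at this
    exact this
  have h4 := eLpNorm_smul_measure_of_ne_top (p := 2) (by norm_num) (f : ℝ → ℂ)
    (ENNReal.ofReal |c|) (μ := Measure.map (c * ·) (volume : Measure ℝ))
  rw [hsm, smul_eq_mul, abs_of_pos hc, ENNReal.ofReal_rpow_of_pos hc] at h4
  rw [h3, h4, Real.sqrt_eq_rpow]
  norm_num

theorem ae_dilation {c : ℝ} (hc : 0 < c) {P : ℝ → Prop}
    (h : ∀ᵐ x ∂(volume : Measure ℝ), P x) : ∀ᵐ x ∂(volume : Measure ℝ), P (c * x) := by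
  have h1 : ∀ᵐ x ∂(Measure.map (c * ·) (volume : Measure ℝ)), P x := by
    rw [Real.map_volume_mul_left hc.ne']
    exact Measure.ae_smul_measure h _
  exact ae_of_ae_map (by fun_prop) h1

/-- The isometric dilation `(dilationIsom c f)(x) = √c f(c x)` of `L²(ℝ; ℂ)`. -/
def dilationIsom {c : ℝ} (hc : 0 < c) : Qumode →ₗᵢ[ℂ] Qumode where
  toFun := fun f => (memLp_dilation hc f).toLp _
  map_add' := fun f g => by
    rw [← MemLp.toLp_add]
    refine MemLp.toLp_congr _ _ ?_
    filter_upwards [ae_dilation hc (Lp.coeFn_add f g)] with x hx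
    rw [hx]
    simp [mul_add]
  map_smul' := fun a f => by
    rw [RingHom.id_apply, ← MemLp.toLp_const_smul]
    refine MemLp.toLp_congr _ _ ?_
    filter_upwards [ae_dilation hc (Lp.coeFn_smul a f)] with x hx
    rw [hx]
    simp [mul_left_comm]
  norm_map' := fun f => by
    simp [Lp.norm_def, eLpNorm_dilation hc f, eLpNorm_congr_ae (MemLp.coeFn_toLp _)]

theorem coeFn_dilationIsom {c : ℝ} (hc : 0 < c) (f : Qumode) :
    dilationIsom hc f =ᵐ[volume] fun x => ((Real.sqrt c : ℝ) : ℂ) * f (c * x) :=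
  (memLp_dilation hc f).coeFn_toLp

theorem dilationIsom_surjective {c : ℝ} (hc : 0 < c) :
    Function.Surjective (dilationIsom hc) := by
  intro f
  refine ⟨dilationIsom (inv_pos.mpr hc) f, Lp.ext ?_⟩
  filter_upwards [coeFn_dilationIsom hc (dilationIsom (inv_pos.mpr hc) f),
    ae_dilation hc (coeFn_dilationIsom (inv_pos.mpr hc) f)] with x h1 h2
  rw [h1, h2, ← mul_assoc, ← mul_assoc, inv_mul_cancel₀ hc.ne', one_mul, ← Complex.ofReal_mul,
    ← Real.sqrt_mul hc.le, mul_inv_cancel₀ hc.ne']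
  simp

/-- The unitary dilation `(dilation c f)(x) = √c f(c x)` of `L²(ℝ; ℂ)`. -/
def dilation {c : ℝ} (hc : 0 < c) : Qumode ≃ₗᵢ[ℂ] Qumode :=
  LinearIsometryEquiv.ofSurjective (dilationIsom hc) (dilationIsom_surjective hc)

theorem two_pi_inv_pos : 0 < (2 * Real.pi)⁻¹ := inv_pos.mpr Real.two_pi_pos

/-- The unitary passage from position wave functions to momentum wave functions,
`(momentumRep f)(p) = ⟨p|f⟩ = (2π)^(-1/2) ∫ e^{ipx} f(x) dx`, where the momentum basis `|p⟩` has
the position wave functions `⟨x|p⟩ = (2π)^(-1/2) e^{-ipx}`. Mathlib's inverse Fourier transform is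
`g(ξ) = ∫ e^{2πiξx} f(x) dx`, so that `(momentumRep f)(p) = (2π)^(-1/2) g(p / (2π))`;
see `momentumRep_toLp`. -/
def momentumRep : Qumode ≃ₗᵢ[ℂ] Qumode :=
  (Lp.fourierTransformₗᵢ ℝ ℂ).symm.trans (dilation two_pi_inv_pos)

/-- The momentum wave function of a Schwartz function is given by the integral formula. -/
theorem momentumRep_toLp (f : SchwartzMap ℝ ℂ) :
    momentumRep (f.toLp 2) =ᵐ[volume] fun p : ℝ =>
      ((Real.sqrt (2 * Real.pi))⁻¹ : ℂ) * ∫ x : ℝ, Complex.exp (Complex.I * p * x) * f x := by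
  have h0 : (Lp.fourierTransformₗᵢ ℝ ℂ).symm (f.toLp 2)
      = (FourierTransformInv.fourierInv f).toLp 2 := SchwartzMap.toLp_fourierInv_eq f
  have h1 : momentumRep (f.toLp 2)
      = dilationIsom two_pi_inv_pos ((FourierTransformInv.fourierInv f).toLp 2) := by
    rw [← h0]
    rfl
  rw [h1]
  filter_upwards [coeFn_dilationIsom two_pi_inv_pos ((FourierTransformInv.fourierInv f).toLp 2),
    ae_dilation two_pi_inv_pos (SchwartzMap.coeFn_toLp (FourierTransformInv.fourierInv f) 2
      (volume : Measure ℝ))] with p hp hq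
  rw [hp, hq, SchwartzMap.fourierInv_coe, Real.fourierInv_eq']
  congr 1
  · simp
  · refine integral_congr_ae (Eventually.of_forall fun x => ?_)
    simp only [RCLike.inner_apply, conj_trivial, smul_eq_mul]
    congr 2
    have := Real.pi_ne_zero
    push_cast
    field_simp

/-! ### The logistic control state -/

/-- The logistic probability density with location parameter `0` and scale parameter `T`. -/
def logisticDensity (T p : ℝ) : ℝ :=
  Real.exp (p / T) / (T * (Real.exp (p / T) + 1) ^ 2)

theorem logisticDensity_nonneg {T : ℝ} (hT : 0 < T) (p : ℝ) : 0 ≤ logisticDensity T p := by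
  unfold logisticDensity
  positivity

theorem continuous_logisticDensity {T : ℝ} (hT : 0 < T) : Continuous (logisticDensity T) := by
  unfold logisticDensity
  refine Continuous.div (by fun_prop) (by fun_prop) fun p => ?_
  positivity

theorem hasDerivAt_logistic {T : ℝ} (hT : 0 < T) (p : ℝ) :
    HasDerivAt (fun p => 1 - (Real.exp (p / T) + 1)⁻¹) (logisticDensity T p) p := by
  have h := ((((hasDerivAt_id p).div_const T).exp.add_const 1).inv
    (by positivity : Real.exp (id p / T) + 1 ≠ 0)).const_sub 1
  refine h.congr_deriv ?_
  simp only [logisticDensity, id]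
  field_simp

theorem integrable_logisticDensity {T : ℝ} (hT : 0 < T) :
    Integrable (logisticDensity T) (volume : Measure ℝ) := by
  refine integrable_of_intervalIntegral_norm_bounded (l := atTop) (a := fun n : ℝ => -n)
    (b := fun n : ℝ => n) 1
    (fun n => ((continuous_logisticDensity hT).integrableOn_Icc).mono_set Set.Ioc_subset_Icc_self)
    tendsto_neg_atTop_atBot tendsto_id (Eventually.of_forall fun n => ?_)
  have h1 : ∫ x in (-n)..n, ‖logisticDensity T x‖ = ∫ x in (-n)..n, logisticDensity T x := by
    simp_rw [Real.norm_of_nonneg (logisticDensity_nonneg hT _)]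
  rw [h1, intervalIntegral.integral_eq_sub_of_hasDerivAt (fun x _ => hasDerivAt_logistic hT x)
    ((continuous_logisticDensity hT).intervalIntegrable _ _)]
  have h2 : 0 ≤ (Real.exp (n / T) + 1)⁻¹ := by positivity
  have h3 : (Real.exp (-n / T) + 1)⁻¹ ≤ 1 :=
    inv_le_one_of_one_le₀ (by linarith [Real.exp_pos (-n / T)])
  linarith

theorem memLp_sqrt_logisticDensity {T : ℝ} (hT : 0 < T) :
    MemLp (fun p => ((Real.sqrt (logisticDensity T p) : ℝ) : ℂ)) 2 (volume : Measure ℝ) := by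
  refine MemLp.ofReal ?_
  have hc : Continuous fun p => Real.sqrt (logisticDensity T p) :=
    Real.continuous_sqrt.comp (continuous_logisticDensity hT)
  rw [memLp_two_iff_integrable_sq hc.aestronglyMeasurable]
  simp_rw [Real.sq_sqrt (logisticDensity_nonneg hT _)]
  exact integrable_logisticDensity hT

/-- The control state vector `|ψ_T⟩ = ∫ √(ℓ_T(p)) |p⟩ dp`: the vector of the qumode whose momentum
wave function is `p ↦ √(ℓ_T(p))`. -/
def controlState {T : ℝ} (hT : 0 < T) : Qumode :=
  momentumRep.symm ((memLp_sqrt_logisticDensity hT).toLp _)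

/-! ### Tensor products of operators -/

/-- The operator `X ⊗ Y` on `L²(ℝ; ℂ) ⊗ ℂ^d = L²(ℝ; ℂ^d)`: with `g = ∑ k, g_k ⊗ e_k`, it is given by
`(X ⊗ Y) g = ∑ j k, Y j k • (X g_k) ⊗ e_j`. -/
def opTensor {d : ℕ} (X : Qumode →L[ℂ] Qumode) (Y : Matrix (Fin d) (Fin d) ℂ) :
    Joint d →L[ℂ] Joint d :=
  ∑ j, ∑ k, Y j k •
    ((ContinuousLinearMap.toSpanSingleton ℂ
        (EuclideanSpace.single j (1 : ℂ) : Data d)).compLpL 2 volume ∘L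
      X ∘L (EuclideanSpace.proj k : Data d →L[ℂ] ℂ).compLpL 2 volume)

/-! ### Hamiltonian evolution -/

section Evolution

variable {d : ℕ}

/-- The position-quadrature operator `x̂` is multiplication by `x`, so `x̂ ⊗ A` acts on
`L²(ℝ; ℂ^d)` by `g ↦ (x ↦ (x A) g(x))`, and `e^{-i t x̂ ⊗ A}` acts by `g ↦ (x ↦ e^{-i t x A} g(x))`.
This is the operator `e^{-i t x A}` on `ℂ^d`. -/
def evolutionFibre (A : Matrix (Fin d) (Fin d) ℂ) (t x : ℝ) : Data d →L[ℂ] Data d :=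
  NormedSpace.exp ((-(Complex.I * t)) • ((x : ℂ) • Matrix.toEuclideanCLM (𝕜 := ℂ) A))

theorem continuous_evolutionFibre (A : Matrix (Fin d) (Fin d) ℂ) (t : ℝ) :
    Continuous (evolutionFibre A t) := by
  unfold evolutionFibre
  let _ : NormedAlgebra ℚ (Data d →L[ℂ] Data d) := NormedAlgebra.restrictScalars ℚ ℂ _
  exact NormedSpace.exp_continuous.comp (by fun_prop)

theorem evolutionFibre_mem_unitary {A : Matrix (Fin d) (Fin d) ℂ} (hA : A.IsHermitian)
    (t x : ℝ) : evolutionFibre A t x ∈ unitary (Data d →L[ℂ] Data d) := by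
  let _ : NormedAlgebra ℚ (Data d →L[ℂ] Data d) := NormedAlgebra.restrictScalars ℚ ℂ _
  refine NormedSpace.exp_mem_unitary_of_mem_skewAdjoint (skewAdjoint.mem_iff.mpr ?_)
  have h : star (Matrix.toEuclideanCLM (𝕜 := ℂ) A) = Matrix.toEuclideanCLM (𝕜 := ℂ) A := by
    rw [← map_star, Matrix.star_eq_conjTranspose, hA.eq]
  simp only [star_smul, h, star_neg, star_mul', RCLike.star_def, Complex.conj_I,
    Complex.conj_ofReal]
  module

theorem norm_evolutionFibre_le {A : Matrix (Fin d) (Fin d) ℂ} (hA : A.IsHermitian) (t x : ℝ) :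
    ‖evolutionFibre A t x‖ ≤ 1 := by
  have h := Unitary.star_mul_self_of_mem (evolutionFibre_mem_unitary hA t x)
  have h2 : ‖evolutionFibre A t x‖ * ‖evolutionFibre A t x‖ ≤ 1 := by
    rw [← CStarRing.norm_star_mul_self, h]
    exact ContinuousLinearMap.norm_id_le
  nlinarith [norm_nonneg (evolutionFibre A t x)]

/-- The Hamiltonian evolution `e^{-i t x̂ ⊗ A}` on the control and data registers. -/
def evolution {A : Matrix (Fin d) (Fin d) ℂ} (hA : A.IsHermitian) (t : ℝ) :
    Joint d →L[ℂ] Joint d :=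
  mulOp (evolutionFibre A t) (continuous_evolutionFibre A t).stronglyMeasurable
    (norm_evolutionFibre_le hA t)

end Evolution

/-! ### Momentum measurement -/

/-- The multiplication operator by the indicator function of `B`. -/
def indicatorOp (B : Set ℝ) (hB : MeasurableSet B) : Qumode →L[ℂ] Qumode :=
  mulOp (B.indicator fun _ => (1 : ℂ →L[ℂ] ℂ)) (stronglyMeasurable_const.indicator hB)
    (fun _ => (norm_indicator_le_norm_self _ _).trans ContinuousLinearMap.norm_id_le)

/-- The projection-valued measure `B ↦ ∫_B |p⟩⟨p| dp` of the measurement of the qumode in the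
momentum basis. -/
def momentumPVM (B : Set ℝ) (hB : MeasurableSet B) : Qumode →L[ℂ] Qumode :=
  (momentumRep.symm : Qumode →L[ℂ] Qumode) ∘L indicatorOp B hB ∘L
    (momentumRep : Qumode →L[ℂ] Qumode)

/-- `HasTrace X z` means `Tr[X] = z`: in every Hilbert basis, the sum of the diagonal entries of `X`
converges unconditionally to `z`. -/
def HasTrace {H : Type} [NormedAddCommGroup H] [InnerProductSpace ℂ H] (X : H →L[ℂ] H)
    (z : ℂ) : Prop :=
  ∀ (ι : Type) (b : HilbertBasis ι ℂ H), HasSum (fun i => ⟪b i, X (b i)⟫_ℂ) z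

/-! ### The algorithm -/

section Circuit

variable {d : ℕ}

/-- The joint state `|ψ_{T₁}⟩⟨ψ_{T₁}| ⊗ ρ` of control and data registers. -/
def preparedState {T₁ : ℝ} (hT₁ : 0 < T₁) (ρ : Matrix (Fin d) (Fin d) ℂ) :
    Joint d →L[ℂ] Joint d :=
  opTensor (InnerProductSpace.rankOne ℂ (controlState hT₁) (controlState hT₁)) ρ

/-- The joint state after the evolution `e^{-i x̂ ⊗ A / T₂}`. -/
def evolvedState {T₁ : ℝ} (hT₁ : 0 < T₁) (T₂ : ℝ) {A : Matrix (Fin d) (Fin d) ℂ}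
    (hA : A.IsHermitian) (ρ : Matrix (Fin d) (Fin d) ℂ) : Joint d →L[ℂ] Joint d :=
  evolution hA (1 / T₂) ∘L preparedState hT₁ ρ ∘L
    ContinuousLinearMap.adjoint (evolution hA (1 / T₂))

/-- The classical post-processing of the momentum outcome `p`: output `0` if `p ≥ 0`, and `1` if
`p < 0`. -/
def output (p : ℝ) : Fin 2 := if 0 ≤ p then 0 else 1

theorem measurable_output : Measurable output :=
  Measurable.ite measurableSet_Ici measurable_const measurable_const

/-- The algorithm with parameters `T₁`, `T₂`, Hamiltonian `A` and input state `ρ` outputs `k` with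
probability `z` (Born rule for the momentum measurement of the control register). -/
def OutputsWithProb {T₁ : ℝ} (hT₁ : 0 < T₁) (T₂ : ℝ) {A : Matrix (Fin d) (Fin d) ℂ}
    (hA : A.IsHermitian) (ρ : Matrix (Fin d) (Fin d) ℂ) (k : Fin 2) (z : ℂ) : Prop :=
  HasTrace (opTensor (momentumPVM (output ⁻¹' {k}) (measurable_output (measurableSet_singleton k)))
    (1 : Matrix (Fin d) (Fin d) ℂ) ∘L evolvedState hT₁ T₂ hA ρ) z

/-- The Fermi–Dirac measurement operator `M_T(A) = (e^{A/T} + I)⁻¹`. -/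
def fermiDirac (T : ℝ) (A : Matrix (Fin d) (Fin d) ℂ) : Matrix (Fin d) (Fin d) ℂ :=
  (NormedSpace.exp (((1 / T : ℝ) : ℂ) • A) + 1)⁻¹

end Circuit

end FermiDirac

end

/-! ### Modulations, translations and the logistic integrals -/
namespace FermiDirac

/-! Diagonalise A. On an eigenvector with eigenvalue a the evolution only multiplies the position
wave function of the control by e^{-ixa/T₂}, which translates its momentum wave function by a/T₂
(`momentumRep_modulation`). The outcome p then has density ℓ_{T₁}(p - a/T₂), and p < 0 has the
logistic probability (e^{a/(T₁T₂)} + 1)⁻¹, the eigenvalue of M_{T₁T₂}(A) at that eigenvector.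

For general ρ, the measurement acts on the control alone, so orthogonality of the eigenvectors
removes all cross terms (`inner_evolution_tensor`), and the effective data measurement is diagonal
in the eigenbasis of A. The operator to be traced is a finite sum of rank-one operators, so Parseval
evaluates its trace in every Hilbert basis (`hasTrace_sum_rankOne`). -/

theorem norm_exp_neg_I_mul_le (s x : ℝ) : ‖Complex.exp (-(Complex.I * s) * x)‖ ≤ 1 := by
  simp [Complex.norm_exp]

/-- Multiplication by the phase `x ↦ e^{-isx}` on `L²(ℝ; ℂ)`. -/
noncomputable def modulation (s : ℝ) : Qumode →L[ℂ] Qumode :=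
  mulOp (fun x : ℝ => Complex.exp (-(Complex.I * s) * x) • (1 : ℂ →L[ℂ] ℂ))
    (Continuous.stronglyMeasurable (by fun_prop))
    (fun x => by
      rw [norm_smul, norm_one, mul_one]
      exact norm_exp_neg_I_mul_le s x)

theorem coeFn_modulation (s : ℝ) (f : Qumode) :
    modulation s f =ᵐ[volume] fun x : ℝ => Complex.exp (-(Complex.I * s) * x) * f x := by
  filter_upwards [coeFn_mulOp (fun x : ℝ => Complex.exp (-(Complex.I * s) * x) • (1 : ℂ →L[ℂ] ℂ))
    _ _ f] with x hx
  exact hx.trans (by simp)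

/-- Translation `f ↦ (p ↦ f (p - s))` on `L²(ℝ; ℂ)`. -/
noncomputable def translation (s : ℝ) : Qumode →ₗᵢ[ℂ] Qumode :=
  Lp.compMeasurePreservingₗᵢ ℂ (fun p : ℝ => p - s) (measurePreserving_sub_right volume s)

theorem coeFn_translation (s : ℝ) (f : Qumode) :
    translation s f =ᵐ[volume] fun p : ℝ => f (p - s) :=
  Lp.coeFn_compMeasurePreserving f (measurePreserving_sub_right volume s)

/-- Every derivative is a constant times the phase, so the bound |s|^n with growth exponent 0
suffices. Hence modulation preserves Schwartz functions. -/
theorem hasTemperateGrowth_cexp (s : ℝ) :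
    Function.HasTemperateGrowth fun x : ℝ => Complex.exp (-(Complex.I * s) * x) := by
  have hd (n : ℕ) : iteratedDeriv n (fun x : ℝ => Complex.exp (-(Complex.I * s) * x))
      = fun x : ℝ => (-(Complex.I * s)) ^ n * Complex.exp (-(Complex.I * s) * x) := by
    induction n with
    | zero => simp
    | succ n ih =>
      rw [iteratedDeriv_succ, ih]
      ext x
      have h : HasDerivAt (fun x : ℝ => (-(Complex.I * s)) * (x : ℂ)) (-(Complex.I * s)) x := by
        simpa using (Complex.ofRealCLM.hasDerivAt (x := x)).const_mul (-(Complex.I * s))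
      rw [(h.cexp.const_mul _).deriv]
      ring
  refine ⟨?_, fun n => ⟨0, |s| ^ n, fun x => ?_⟩⟩
  · exact Complex.contDiff_exp.comp (contDiff_const.mul Complex.ofRealCLM.contDiff)
  · rw [norm_iteratedFDeriv_eq_norm_iteratedDeriv, hd n, norm_mul, pow_zero]
    refine mul_le_mul (by simp) (norm_exp_neg_I_mul_le s x) (norm_nonneg _) (by positivity)

/-- Both sides are continuous in `f`, so Schwartz functions suffice; there the phase e^{-isx} merges
with e^{ipx} in the integral formula. -/
theorem momentumRep_modulation (s : ℝ) (f : Qumode) :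
    momentumRep (modulation s f) = translation s (momentumRep f) := by
  have hd : DenseRange fun g : SchwartzMap ℝ ℂ => g.toLp 2 (volume : Measure ℝ) :=
    SchwartzMap.denseRange_toLpCLM (p := 2) ENNReal.ofNat_ne_top
  refine congrFun (hd.equalizer (momentumRep.continuous.comp (modulation s).continuous)
    ((translation s).continuous.comp momentumRep.continuous) ?_) f
  funext g
  set h : SchwartzMap ℝ ℂ :=
    SchwartzMap.smulLeftCLM ℂ (fun x : ℝ => Complex.exp (-(Complex.I * s) * x)) g with hh
  have hmod : modulation s (g.toLp 2) = h.toLp 2 := by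
    refine Lp.ext ?_
    filter_upwards [coeFn_modulation s (g.toLp 2), g.coeFn_toLp 2 (volume : Measure ℝ),
      h.coeFn_toLp 2 (volume : Measure ℝ)] with x h1 h2 h3
    rw [h1, h2, h3, hh, SchwartzMap.smulLeftCLM_apply_apply (hasTemperateGrowth_cexp s),
      smul_eq_mul]
  simp only [Function.comp_apply, hmod]
  refine Lp.ext ?_
  filter_upwards [momentumRep_toLp h, coeFn_translation s (momentumRep (g.toLp 2)),
    (measurePreserving_sub_right volume s).quasiMeasurePreserving.ae (momentumRep_toLp g)]
    with p h1 h2 h3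
  rw [h1, h2, h3]
  congr 1
  refine integral_congr_ae (Eventually.of_forall fun x => ?_)
  simp only [hh, SchwartzMap.smulLeftCLM_apply_apply (hasTemperateGrowth_cexp s), smul_eq_mul]
  rw [← mul_assoc, ← Complex.exp_add]
  congr 2
  push_cast
  ring

theorem coeFn_indicatorOp (B : Set ℝ) (hB : MeasurableSet B) (f : Qumode) :
    indicatorOp B hB f =ᵐ[volume] B.indicator f := by
  filter_upwards [coeFn_mulOp (B.indicator fun _ => (1 : ℂ →L[ℂ] ℂ)) _ _ f] with x hx
  refine hx.trans ?_
  by_cases h : x ∈ B <;> simp [h]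

theorem inner_momentumPVM (B : Set ℝ) (hB : MeasurableSet B) (f : Qumode) :
    ⟪f, momentumPVM B hB f⟫_ℂ = ((∫ p in B, ‖momentumRep f p‖ ^ 2 : ℝ) : ℂ) := by
  have h : ⟪f, momentumPVM B hB f⟫_ℂ
      = ⟪momentumRep f, indicatorOp B hB (momentumRep f)⟫_ℂ := by
    rw [← momentumRep.inner_map_map f]
    simp [momentumPVM]
  rw [h, L2.inner_def, ← integral_complex_ofReal, ← integral_indicator hB]
  refine integral_congr_ae ?_
  filter_upwards [coeFn_indicatorOp B hB (momentumRep f)] with p hp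
  rw [hp]
  by_cases h : p ∈ B
  · simp [h]
  · simp [h]

/-- Born rule for one eigenvalue: the squared modulus of the translated √ℓ_T is the translated
density. -/
theorem inner_modulation_controlState {T : ℝ} (hT : 0 < T) (s : ℝ) (B : Set ℝ)
    (hB : MeasurableSet B) :
    ⟪modulation s (controlState hT), momentumPVM B hB (modulation s (controlState hT))⟫_ℂ
      = ((∫ p in B, logisticDensity T (p - s) : ℝ) : ℂ) := by
  rw [inner_momentumPVM, momentumRep_modulation, controlState, LinearIsometryEquiv.apply_symm_apply]
  congr 1
  refine integral_congr_ae (ae_restrict_of_ae ?_)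
  filter_upwards [coeFn_translation s ((memLp_sqrt_logisticDensity hT).toLp _),
    (measurePreserving_sub_right volume s).quasiMeasurePreserving.ae
      (memLp_sqrt_logisticDensity hT).coeFn_toLp] with p h1 h2
  rw [h1, h2, Complex.norm_real, Real.norm_eq_abs, sq_abs,
    Real.sq_sqrt (logisticDensity_nonneg hT _)]

theorem integral_Ioi_logisticDensity {T : ℝ} (hT : 0 < T) (s : ℝ) :
    ∫ p in Set.Ioi 0, logisticDensity T (p - s) = 1 - (Real.exp (s / T) + 1)⁻¹ := by
  have hlim : Tendsto (fun p => 1 - (Real.exp ((p - s) / T) + 1)⁻¹) atTop (𝓝 (1 - 0)) := by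
    refine tendsto_const_nhds.sub (tendsto_inv_atTop_zero.comp ?_)
    refine tendsto_atTop_add_const_right _ _ (Real.tendsto_exp_atTop.comp ?_)
    exact (tendsto_atTop_add_const_right _ (-s) tendsto_id).atTop_div_const hT
  rw [integral_Ioi_of_hasDerivAt_of_tendsto'
    (fun p _ => (hasDerivAt_logistic hT (p - s)).comp_sub_const p s)
    ((integrable_logisticDensity hT).comp_sub_right s).integrableOn hlim]
  -- The antiderivative at p = 0 is 1 - (e^{-s/T} + 1)⁻¹ = (e^{s/T} + 1)⁻¹.
  rw [zero_sub, neg_div, Real.exp_neg]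
  have := Real.exp_pos (s / T)
  field_simp
  ring

theorem integral_Iio_logisticDensity {T : ℝ} (hT : 0 < T) (s : ℝ) :
    ∫ p in Set.Iio 0, logisticDensity T (p - s) = (Real.exp (s / T) + 1)⁻¹ := by
  have hlim : Tendsto (fun p => 1 - (Real.exp ((p - s) / T) + 1)⁻¹) atBot
      (𝓝 (1 - (0 + 1)⁻¹)) := by
    refine tendsto_const_nhds.sub (Tendsto.inv₀ ?_ (by norm_num))
    refine (Real.tendsto_exp_atBot.comp ?_).add_const 1
    exact (tendsto_atBot_add_const_right _ (-s) tendsto_id).atBot_div_const hT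
  rw [← integral_Iic_eq_integral_Iio, integral_Iic_of_hasDerivAt_of_tendsto'
    (fun p _ => (hasDerivAt_logistic hT (p - s)).comp_sub_const p s)
    ((integrable_logisticDensity hT).comp_sub_right s).integrableOn hlim]
  rw [zero_sub, neg_div, Real.exp_neg]
  have := Real.exp_pos (s / T)
  field_simp
  ring

variable {d : ℕ}

/-! ### Exponentials on eigenvectors -/

/-- Apply the exponential series to `v` term by term. -/
theorem exp_apply_of_apply_eq_smul {S : Data d →L[ℂ] Data d} {a : ℂ} {v : Data d}
    (h : S v = a • v) : NormedSpace.exp S v = Complex.exp a • v := by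
  have hpow (n : ℕ) : (S ^ n) v = a ^ n • v := by
    induction n with
    | zero => simp
    | succ n ih => rw [pow_succ', mul_apply_eq_comp, ih, map_smul, h, smul_smul, pow_succ]
  have h1 := (NormedSpace.exp_series_hasSum_exp' (𝕂 := ℂ) S).mapL (ContinuousLinearMap.apply ℂ _ v)
  have h2 := (NormedSpace.exp_series_hasSum_exp' (𝕂 := ℂ) a).smul_const v
  rw [← Complex.exp_eq_exp_ℂ] at h2
  have h3 : (fun n : ℕ => ContinuousLinearMap.apply ℂ (Data d) v ((n.factorial⁻¹ : ℂ) • S ^ n))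
      = fun n : ℕ => ((n.factorial⁻¹ : ℂ) • a ^ n) • v := by
    funext n
    rw [map_smul, ContinuousLinearMap.apply_apply, hpow, smul_assoc]
  exact h1.unique (h3 ▸ h2)

theorem toEuclideanCLM_exp (A : Matrix (Fin d) (Fin d) ℂ) :
    Matrix.toEuclideanCLM (𝕜 := ℂ) (NormedSpace.exp A)
      = NormedSpace.exp (Matrix.toEuclideanCLM (𝕜 := ℂ) A) := by
  -- Any Banach algebra norm inducing the usual topology serves here; the exponential does not
  -- depend on the choice.
  let _ : NormedRing (Matrix (Fin d) (Fin d) ℂ) := Matrix.linftyOpNormedRing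
  let _ : NormedAlgebra ℂ (Matrix (Fin d) (Fin d) ℂ) := Matrix.linftyOpNormedAlgebra
  let _ : NormedAlgebra ℚ (Matrix (Fin d) (Fin d) ℂ) := NormedAlgebra.restrictScalars ℚ ℂ _
  exact NormedSpace.map_exp (Matrix.toEuclideanCLM (n := Fin d) (𝕜 := ℂ))
    (LinearMap.continuous_of_finiteDimensional
      (Matrix.toEuclideanCLM (n := Fin d) (𝕜 := ℂ)).toAlgEquiv.toLinearMap) A

theorem toEuclideanCLM_eigenvectorBasis {A : Matrix (Fin d) (Fin d) ℂ} (hA : A.IsHermitian)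
    (m : Fin d) : Matrix.toEuclideanCLM (𝕜 := ℂ) A (hA.eigenvectorBasis m)
      = (hA.eigenvalues m : ℂ) • hA.eigenvectorBasis m := by
  ext i
  simpa using congrFun (hA.mulVec_eigenvectorBasis m) i

theorem evolutionFibre_eigenvectorBasis {A : Matrix (Fin d) (Fin d) ℂ} (hA : A.IsHermitian)
    (t x : ℝ) (m : Fin d) : evolutionFibre A t x (hA.eigenvectorBasis m)
      = Complex.exp (-(Complex.I * (t * hA.eigenvalues m : ℝ)) * x) • hA.eigenvectorBasis m := by
  refine exp_apply_of_apply_eq_smul ?_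
  simp only [smul_apply, toEuclideanCLM_eigenvectorBasis, smul_smul]
  congr 1
  push_cast
  ring

/-- The exponential is H Hᴴ with H the exponential of half the exponent, hence positive
semidefinite. Adding 1 gives invertibility, so the inverse in `fermiDirac` is a genuine one. -/
theorem posDef_exp_add_one {A : Matrix (Fin d) (Fin d) ℂ} (hA : A.IsHermitian) (t : ℝ) :
    (NormedSpace.exp ((t : ℂ) • A) + 1).PosDef := by
  have hH : (((t / 2 : ℝ) : ℂ) • A).IsHermitian := by
    simp [Matrix.IsHermitian, Matrix.conjTranspose_smul, hA.eq]
  have h : NormedSpace.exp ((t : ℂ) • A) = NormedSpace.exp (((t / 2 : ℝ) : ℂ) • A)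
      * (NormedSpace.exp (((t / 2 : ℝ) : ℂ) • A)).conjTranspose := by
    rw [← Matrix.exp_conjTranspose, hH.eq, ← Matrix.exp_add_of_commute _ _ (Commute.refl _),
      ← add_smul]
    congr 2
    push_cast
    ring
  rw [h]
  exact Matrix.PosDef.posSemidef_add (Matrix.posSemidef_self_mul_conjTranspose _) Matrix.PosDef.one

theorem fermiDirac_eigenvectorBasis {A : Matrix (Fin d) (Fin d) ℂ} (hA : A.IsHermitian)
    (T : ℝ) (m : Fin d) : Matrix.toEuclideanCLM (𝕜 := ℂ) (fermiDirac T A) (hA.eigenvectorBasis m)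
      = (((Real.exp (hA.eigenvalues m / T) + 1)⁻¹ : ℝ) : ℂ) • hA.eigenvectorBasis m := by
  set N := NormedSpace.exp (((1 / T : ℝ) : ℂ) • A) + 1 with hN
  set v := hA.eigenvectorBasis m
  set r : ℝ := Real.exp (hA.eigenvalues m / T) + 1 with hr
  have hr0 : (r : ℂ) ≠ 0 := by
    exact_mod_cast (by positivity : r ≠ 0)
  have h1 : Matrix.toEuclideanCLM (𝕜 := ℂ) N v = (r : ℂ) • v := by
    rw [hN, map_add, map_one, toEuclideanCLM_exp, add_apply,
      exp_apply_of_apply_eq_smul (a := ((hA.eigenvalues m / T : ℝ) : ℂ))]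
    · simp [hr, add_smul]
    · rw [map_smul, smul_apply, toEuclideanCLM_eigenvectorBasis, smul_smul]
      congr 1
      push_cast
      ring
  have h2 : N⁻¹ * N = 1 :=
    Matrix.nonsing_inv_mul _ ((Matrix.isUnit_iff_isUnit_det _).mp
      (posDef_exp_add_one hA (1 / T)).isUnit)
  have h3 := congrArg (fun M => Matrix.toEuclideanCLM (𝕜 := ℂ) M v) h2
  simp only [map_mul, mul_apply_eq_comp, h1, map_smul, map_one,
    one_apply_eq_self] at h3
  change Matrix.toEuclideanCLM (𝕜 := ℂ) N⁻¹ v = _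
  -- `h3` reads r • N⁻¹v = v. It replaces `v` on both sides, and its final use restores `v` on the
  -- left.
  rw [← h3, smul_smul, Complex.ofReal_inv, inv_mul_cancel₀ hr0, one_smul, h3]

/-! ### Product vectors -/

/-- The product vector `f ⊗ v`, as a linear function of `v`. -/
noncomputable def tensor (f : Qumode) : Data d →ₗ[ℂ] Joint d where
  toFun v := (ContinuousLinearMap.toSpanSingleton ℂ v).compLpL 2 volume f
  map_add' v w := by
    rw [ContinuousLinearMap.toSpanSingleton_add, ContinuousLinearMap.add_compLpL,
      add_apply]
  map_smul' c v := by
    rw [ContinuousLinearMap.toSpanSingleton_smul, ContinuousLinearMap.smul_compLpL,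
      smul_apply, RingHom.id_apply]

theorem coeFn_tensor (f : Qumode) (v : Data d) :
    tensor f v =ᵐ[volume] fun x => f x • v :=
  (ContinuousLinearMap.toSpanSingleton ℂ v).coeFn_compLpL f

theorem inner_tensor_tensor (f g : Qumode) (v w : Data d) :
    ⟪tensor f v, tensor g w⟫_ℂ = ⟪v, w⟫_ℂ * ⟪f, g⟫_ℂ := by
  rw [L2.inner_def, L2.inner_def, ← integral_const_mul]
  refine integral_congr_ae ?_
  filter_upwards [coeFn_tensor f v, coeFn_tensor g w] with x h1 h2
  rw [h1, h2, inner_smul_left, inner_smul_right, RCLike.inner_apply]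
  ring

/-- Taking the k-th coordinate and pairing with f is pairing with f ⊗ e_k; this exposes |f⟩⟨f| ⊗ ρ
as a finite sum of rank-one operators. -/
theorem inner_tensor_single (f : Qumode) (k : Fin d) (g : Joint d) :
    ⟪tensor f (EuclideanSpace.single k 1), g⟫_ℂ
      = ⟪f, (EuclideanSpace.proj k : Data d →L[ℂ] ℂ).compLpL 2 volume g⟫_ℂ := by
  rw [L2.inner_def, L2.inner_def]
  refine integral_congr_ae ?_
  filter_upwards [coeFn_tensor f (EuclideanSpace.single k (1 : ℂ) : Data d),
    (EuclideanSpace.proj k : Data d →L[ℂ] ℂ).coeFn_compLpL g] with x h1 h2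
  rw [h1, h2, inner_smul_left, EuclideanSpace.inner_single_left, RCLike.inner_apply]
  simp [mul_comm]

theorem compLpL_proj_tensor (f : Qumode) (v : Data d) (k : Fin d) :
    (EuclideanSpace.proj k : Data d →L[ℂ] ℂ).compLpL 2 volume (tensor f v) = v k • f := by
  refine Lp.ext ?_
  filter_upwards [(EuclideanSpace.proj k : Data d →L[ℂ] ℂ).coeFn_compLpL (tensor f v),
    coeFn_tensor f v, Lp.coeFn_smul (v k) f] with x h1 h2 h3
  rw [h1, h2, h3]
  simp [mul_comm]

theorem opTensor_apply (X : Qumode →L[ℂ] Qumode) (Y : Matrix (Fin d) (Fin d) ℂ) (g : Joint d) :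
    opTensor X Y g = ∑ j, ∑ k, Y j k •
      tensor (X ((EuclideanSpace.proj k : Data d →L[ℂ] ℂ).compLpL 2 volume g))
        (EuclideanSpace.single j 1) := by
  simp only [opTensor, sum_apply]
  rfl

theorem tensor_smul_left (c : ℂ) (f : Qumode) (v : Data d) :
    tensor (c • f) v = c • tensor f v :=
  map_smul ((ContinuousLinearMap.toSpanSingleton ℂ v).compLpL 2 volume) c f

theorem opTensor_one_tensor (X : Qumode →L[ℂ] Qumode) (f : Qumode) (v : Data d) :
    opTensor X 1 (tensor f v) = tensor (X f) v := by
  rw [opTensor_apply]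
  simp only [Matrix.one_apply, ite_smul, one_smul, zero_smul, Finset.sum_ite_eq, Finset.mem_univ,
    if_true, compLpL_proj_tensor, map_smul, tensor_smul_left]
  conv_rhs => rw [← (EuclideanSpace.basisFun (Fin d) ℂ).sum_repr v]
  simp [map_sum, map_smul]

theorem opTensor_rankOne_apply (f : Qumode) (ρ : Matrix (Fin d) (Fin d) ℂ) (g : Joint d) :
    opTensor (InnerProductSpace.rankOne ℂ f f) ρ g = ∑ j, ∑ k, (ρ j k *
      ⟪tensor f (EuclideanSpace.single k 1), g⟫_ℂ) • tensor f (EuclideanSpace.single j 1) := by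
  simp only [opTensor_apply, InnerProductSpace.rankOne_apply, tensor_smul_left, smul_smul,
    inner_tensor_single]

/-- In each fibre the eigenvector picks up a scalar phase depending on x, which can be moved to the
control factor. -/
theorem evolution_tensor_eigenvectorBasis {A : Matrix (Fin d) (Fin d) ℂ} (hA : A.IsHermitian)
    (t : ℝ) (f : Qumode) (m : Fin d) :
    evolution hA t (tensor f (hA.eigenvectorBasis m))
      = tensor (modulation (t * hA.eigenvalues m) f) (hA.eigenvectorBasis m) := by
  refine Lp.ext ?_
  filter_upwards [coeFn_mulOp (evolutionFibre A t) (continuous_evolutionFibre A t).stronglyMeasurable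
    (norm_evolutionFibre_le hA t) (tensor f (hA.eigenvectorBasis m)),
    coeFn_tensor f (hA.eigenvectorBasis m), coeFn_modulation (t * hA.eigenvalues m) f,
    coeFn_tensor (modulation (t * hA.eigenvalues m) f) (hA.eigenvectorBasis m)] with x h1 h2 h3 h4
  rw [h4, h3]
  refine h1.trans ?_
  rw [h2, map_smul, evolutionFibre_eigenvectorBasis, smul_smul, mul_comm]

/-! ### The outcome probabilities -/

/-- Expand `u` and `w` in the eigenbasis. Since `P` leaves the data factor alone, orthonormality
there kills the off-diagonal terms, whether or not the modulated control states overlap. -/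
theorem inner_evolution_tensor {A : Matrix (Fin d) (Fin d) ℂ} (hA : A.IsHermitian)
    (t : ℝ) (f : Qumode) (P : Qumode →L[ℂ] Qumode) (u w : Data d) :
    ⟪evolution hA t (tensor f u), opTensor P 1 (evolution hA t (tensor f w))⟫_ℂ
      = ∑ m, ⟪u, hA.eigenvectorBasis m⟫_ℂ * ⟪hA.eigenvectorBasis m, w⟫_ℂ *
        ⟪modulation (t * hA.eigenvalues m) f, P (modulation (t * hA.eigenvalues m) f)⟫_ℂ := by
  have h (z : Data d) : evolution hA t (tensor f z) = ∑ m, ⟪hA.eigenvectorBasis m, z⟫_ℂ •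
      tensor (modulation (t * hA.eigenvalues m) f) (hA.eigenvectorBasis m) := by
    conv_lhs => rw [← hA.eigenvectorBasis.sum_repr' z]
    simp only [map_sum, map_smul, evolution_tensor_eigenvectorBasis]
  rw [h u, h w]
  simp only [map_sum, map_smul, opTensor_one_tensor, sum_inner, inner_sum, inner_smul_left,
    inner_smul_right, inner_tensor_tensor, inner_conj_symm,
    orthonormal_iff_ite.mp hA.eigenvectorBasis.orthonormal, ite_mul, one_mul, zero_mul, mul_ite,
    mul_zero, Finset.sum_ite_eq', Finset.mem_univ, if_true]
  exact Finset.sum_congr rfl fun m _ => by ring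

/-- Parseval gives the trace of each |x_j⟩⟨y_k| as ⟪y_k, x_j⟫, and finite sums of convergent series
converge. -/
theorem hasTrace_sum_rankOne {H : Type} [NormedAddCommGroup H] [InnerProductSpace ℂ H]
    {X : H →L[ℂ] H} (ρ : Matrix (Fin d) (Fin d) ℂ) (x y : Fin d → H)
    (hX : ∀ g, X g = ∑ j, ∑ k, (ρ j k * ⟪y k, g⟫_ℂ) • x j) :
    HasTrace X (∑ j, ∑ k, ρ j k * ⟪y k, x j⟫_ℂ) := by
  intro ι b
  simp only [hX, inner_sum, inner_smul_right, mul_assoc]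
  exact hasSum_sum fun j _ => hasSum_sum fun k _ => (b.hasSum_inner_mul_inner _ _).mul_left _

/-- Entries of the spectral resolution ∑ c_m |b_m⟩⟨b_m|, in the shape produced by
`inner_evolution_tensor`. -/
theorem apply_eq_sum_of_orthonormalBasis (b : OrthonormalBasis (Fin d) ℂ (Data d))
    {G : Matrix (Fin d) (Fin d) ℂ} {c : Fin d → ℂ}
    (hG : ∀ m, Matrix.toEuclideanCLM (𝕜 := ℂ) G (b m) = c m • b m) (k j : Fin d) :
    G k j = ∑ m, ⟪EuclideanSpace.single k (1 : ℂ), b m⟫_ℂ *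
      ⟪b m, EuclideanSpace.single j (1 : ℂ)⟫_ℂ * c m := by
  have h1 : G k j = ⟪EuclideanSpace.single k (1 : ℂ),
      Matrix.toEuclideanCLM (𝕜 := ℂ) G (EuclideanSpace.single j (1 : ℂ))⟫_ℂ := by
    simp [EuclideanSpace.inner_single_left]
  rw [h1]
  conv_lhs => rw [← b.sum_repr' (EuclideanSpace.single j (1 : ℂ))]
  simp only [map_sum, map_smul, hG, inner_sum, inner_smul_right]
  exact Finset.sum_congr rfl fun m _ => by ring

/-- `G` is the effective measurement operator on the data register; its eigenvalues are the outcome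
probabilities for the eigenvectors of `A`. -/
theorem outputsWithProb_of_eigenvectorBasis {T₁ : ℝ} (hT₁ : 0 < T₁) (T₂ : ℝ)
    {A : Matrix (Fin d) (Fin d) ℂ} (hA : A.IsHermitian) (ρ : Matrix (Fin d) (Fin d) ℂ) (k : Fin 2)
    {G : Matrix (Fin d) (Fin d) ℂ}
    (hG : ∀ m, Matrix.toEuclideanCLM (𝕜 := ℂ) G (hA.eigenvectorBasis m)
      = ((∫ p in output ⁻¹' {k}, logisticDensity T₁ (p - 1 / T₂ * hA.eigenvalues m) : ℝ) : ℂ) •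
        hA.eigenvectorBasis m) :
    OutputsWithProb hT₁ T₂ hA ρ k (G * ρ).trace := by
  set P := momentumPVM (output ⁻¹' {k}) (measurable_output (measurableSet_singleton k)) with hP
  set e : Fin d → Data d := fun j => EuclideanSpace.single j 1
  set U := evolution hA (1 / T₂) with hU
  have hX (g : Joint d) : (opTensor P 1 ∘L evolvedState hT₁ T₂ hA ρ) g
      = ∑ j, ∑ l, (ρ j l * ⟪U (tensor (controlState hT₁) (e l)), g⟫_ℂ) •
        opTensor P 1 (U (tensor (controlState hT₁) (e j))) := by
    simp only [evolvedState, preparedState, ContinuousLinearMap.comp_apply,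
      opTensor_rankOne_apply, map_sum, map_smul, ContinuousLinearMap.adjoint_inner_right]
    rfl
  have h := hasTrace_sum_rankOne ρ _ _ hX
  have htr : (G * ρ).trace = ∑ j, ∑ l, ρ j l * ⟪U (tensor (controlState hT₁) (e l)),
      opTensor P 1 (U (tensor (controlState hT₁) (e j)))⟫_ℂ := by
    simp only [Matrix.trace, Matrix.diag_apply, Matrix.mul_apply]
    -- The swap pairs the entry G l j with ρ j l.
    rw [Finset.sum_comm]
    refine Finset.sum_congr rfl fun j _ => Finset.sum_congr rfl fun l _ => ?_
    rw [hU, inner_evolution_tensor, apply_eq_sum_of_orthonormalBasis _ hG, mul_comm]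
    simp only [hP, inner_modulation_controlState]
    rfl
  rw [htr]
  exact h

theorem output_preimage_zero : output ⁻¹' {0} = Set.Ici 0 := by
  ext p
  simp [output]

theorem output_preimage_one : output ⁻¹' {1} = Set.Iio 0 := by
  ext p
  simp [output]

end FermiDirac

open FermiDirac in
theorem mainTheorem11 (d : ℕ) (A : Matrix (Fin d) (Fin d) ℂ) (hA : A.IsHermitian)
    (ρ : Matrix (Fin d) (Fin d) ℂ) (hρ : ρ.PosSemidef) (hρ_tr : ρ.trace = 1)
    (T₁ T₂ : ℝ) (hT₁ : 0 < T₁) (hT₂ : 0 < T₂) :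
    OutputsWithProb hT₁ T₂ hA ρ 0 (((1 - fermiDirac (T₁ * T₂) A) * ρ).trace) ∧
      OutputsWithProb hT₁ T₂ hA ρ 1 ((fermiDirac (T₁ * T₂) A * ρ).trace) := by
  -- The shift a/T₂ measured in units of the logistic scale T₁ produces the product temperature.
  have hs (a : ℝ) : 1 / T₂ * a / T₁ = a / (T₁ * T₂) := by field_simp
  refine ⟨outputsWithProb_of_eigenvectorBasis hT₁ T₂ hA ρ 0 fun m => ?_,
    outputsWithProb_of_eigenvectorBasis hT₁ T₂ hA ρ 1 fun m => ?_⟩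
  -- The endpoint p = 0 is a null set.
  · rw [output_preimage_zero, integral_Ici_eq_integral_Ioi, integral_Ioi_logisticDensity hT₁, hs,
      map_sub, map_one, sub_apply, fermiDirac_eigenvectorBasis,
      Complex.ofReal_sub, sub_smul, Complex.ofReal_one, one_smul, one_apply_eq_self]
  · rw [output_preimage_one, integral_Iio_logisticDensity hT₁, hs, fermiDirac_eigenvectorBasis]
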